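/- Let $G=(V,E)$ be a finite undirected graph without self-edges or multi-edges, let $K$ be the number of topics, and let $c\in[0,\infty)$ (confidence bound), $\mu\in(0,1]$ (compromise parameter) and $\omega\in[0,1]$ (topic weight). For $x,y\in\mathbb{R}^K$ and $k\in\{1,\dots,K\}$ put $$d_k(x,y)=\omega\,|x^k-y^k|+\frac{1-\omega}{K}\sum_{\ell=1}^K|x^\ell-y^\ell| .$$ In the topic-weighted Hegselmann–Krause model, each node $i\in V$ has an opinion vector $x_i(t)\in\mathbb{R}^K$ at each time $t=0,1,2,\dots$, and all opinions are updated simultaneously by $$x_i^k(t+1)=(1-\mu)\,x_i^k(t)+\frac{\mu}{|\mathcal N_i^k(t)|}\sum_{j\in\mathcal N_i^k(t)}x_j^k(t),\qquad \mathcal N_i^k(t)=\{i\}\cup\{j\in V:(i,j)\in E\text{ and }d_k(x_i(t),x_j(t))<c\}.$$ Then, for every initial opinion state $X(0)\in\mathbb{R}^{|V|K}$, the opinion state $X(t)=(x_i(t))_{i\in V}\in\mathbb{R}^{|V|K}$ converges: the limit $X^*=\lim_{t\to\infty}X(t)$ exists in $\mathbb{R}^{|V|K}$. -/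

import Mathlib

open Filter Topology

noncomputable section

namespace TopicHK

/-- Opinion states: node `i` has opinion `X i k` on topic `k`, so a state is a vector with
`M * K` real entries, where `M` is the number of nodes. The topology is the usual one of this
finite-dimensional real vector space (the product topology). -/
abbrev OpinionState (V : Type*) (K : ℕ) : Type _ := V → Fin K → ℝ

/-- The topic-weighted discordance function
`d_k(x, y) = ω |x^k - y^k| + (1 - ω) / K * ∑_ℓ |x^ℓ - y^ℓ|`. -/
def discordance {K : ℕ} (ω : ℝ) (k : Fin K) (x y : Fin K → ℝ) : ℝ :=
  ω * |x k - y k| + (1 - ω) / (K : ℝ) * ∑ l : Fin K, |x l - y l|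

open Classical in
/-- The set `N_i^k = {i} ∪ {j : (i, j) ∈ E and d_k(x_i, x_j) < c}` of the node `i` itself and the
neighbours to which it is receptive on topic `k`, in the opinion state `X`. -/
def receptiveSet {V : Type*} [Fintype V] {K : ℕ} (G : SimpleGraph V) (c ω : ℝ)
    (X : OpinionState V K) (i : V) (k : Fin K) : Finset V :=
  {i} ∪ Finset.univ.filter (fun j => G.Adj i j ∧ discordance ω k (X i) (X j) < c)

/-- One synchronous step of the topic-weighted Hegselmann–Krause model:
`x_i^k ↦ (1 - μ) x_i^k + μ / |N_i^k| * ∑_{j ∈ N_i^k} x_j^k`. -/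
def update {V : Type*} [Fintype V] {K : ℕ} (G : SimpleGraph V) (c μ ω : ℝ)
    (X : OpinionState V K) : OpinionState V K := fun i k =>
  (1 - μ) * X i k
    + μ / ((receptiveSet G c ω X i k).card : ℝ) * ∑ j ∈ receptiveSet G c ω X i k, X j k

/-- The opinion state at time `t` of the topic-weighted Hegselmann–Krause model with initial
opinion state `X₀`. -/
def opinionState {V : Type*} [Fintype V] {K : ℕ} (G : SimpleGraph V) (c μ ω : ℝ)
    (X₀ : OpinionState V K) : ℕ → OpinionState V K
  | 0 => X₀
  | t + 1 => update G c μ ω (opinionState G c μ ω X₀ t)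

end TopicHK

end

/-!
On a fixed topic `k` the model reads `x(t+1) = A(t) x(t)`, where `A(t)` is a row-stochastic matrix
whose nonzero entries are at least `δ = μ / |V|`, whose diagonal entries are nonzero, and whose
zero pattern is symmetric, because the discordance `d_k` is symmetric in its two arguments. The
topics interact only through the choice of `A(t)`. Hence it suffices to show that *every* orbit of
*every* such time-dependent averaging process converges (`IsTypeSymmetricAveraging.tendsto`).

Call two nodes persistently linked if they interact at infinitely many times, and let `C` be a
connected component of this relation. After some time there is no interaction between `C` and its
complement, so the minimum `m(t)` over `C` is nondecreasing and, being bounded, tends to some `L`.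
The heart of the argument is `IsTypeSymmetricAveraging.exists_lower_bound`: if `i ∈ C` at time `t`,
then at some later time all of `C` lies above `m(t) + δ ^ |C| * (x i t - m(t))`. Start from the set
`{i}` of nodes known to be high. As long as it does not interact with its complement, its lower
bound persists; at the first interaction all nodes touched join it, since type-symmetry makes the
averaging act in both directions, at the cost of one factor `δ`. Consequently
`m(t) ≤ x i t ≤ m(t) + (L - m(t)) / δ ^ |C|`, and both sides tend to `L`.
-/

namespace TopicHK

/-! ### Type-symmetric averaging processes -/

/-- A sequence of row-stochastic matrices `a t` whose zero pattern is symmetric, whose diagonal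
does not vanish, and whose nonzero entries are bounded below by `δ > 0` uniformly in time. -/
structure IsTypeSymmetricAveraging {V : Type*} [Fintype V] (δ : ℝ) (a : ℕ → V → V → ℝ) :
    Prop where
  pos : 0 < δ
  nonneg : ∀ t i j, 0 ≤ a t i j
  sum_eq_one : ∀ t i, ∑ j, a t i j = 1
  diag_ne_zero : ∀ t i, a t i i ≠ 0
  le_of_ne_zero : ∀ t i j, a t i j ≠ 0 → δ ≤ a t i j
  symm : ∀ t i j, a t i j ≠ 0 → a t j i ≠ 0

namespace IsTypeSymmetricAveraging

variable {V : Type*} [Fintype V] {δ : ℝ} {a : ℕ → V → V → ℝ} {x : ℕ → V → ℝ}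

theorem add_mul_le_succ (ha : IsTypeSymmetricAveraging δ a)
    (hx : ∀ t i, x (t + 1) i = ∑ j, a t i j * x t j) {t : ℕ} {i p : V} {b ε : ℝ}
    (hb : ∀ j, a t i j ≠ 0 → b ≤ x t j) (hε : 0 ≤ ε) (hp : a t i p ≠ 0) (hpx : b + ε ≤ x t p) :
    b + δ * ε ≤ x (t + 1) i := by
  have hnn : ∀ j ∈ Finset.univ, 0 ≤ a t i j * (x t j - b) := by
    intro j _
    by_cases h : a t i j = 0
    · simp [h]
    · exact mul_nonneg (ha.nonneg t i j) (sub_nonneg.2 (hb j h))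
  have hsum : x (t + 1) i - b = ∑ j, a t i j * (x t j - b) := by
    simp only [mul_sub, Finset.sum_sub_distrib, ← Finset.sum_mul, ha.sum_eq_one, hx, one_mul]
  have h1 := Finset.single_le_sum hnn (Finset.mem_univ p)
  have h2 : δ * ε ≤ a t i p * (x t p - b) :=
    mul_le_mul (ha.le_of_ne_zero t i p hp) (by linarith) hε (ha.nonneg t i p)
  linarith

theorem le_succ (ha : IsTypeSymmetricAveraging δ a)
    (hx : ∀ t i, x (t + 1) i = ∑ j, a t i j * x t j) {t : ℕ} {i : V} {b : ℝ}
    (hb : ∀ j, a t i j ≠ 0 → b ≤ x t j) : b ≤ x (t + 1) i := by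
  have hi := ha.diag_ne_zero t i
  simpa using ha.add_mul_le_succ hx hb le_rfl hi (by simpa using hb i hi)

/-- A lower bound on `S` persists for as long as `S` does not interact with its complement. -/
theorem le_of_no_crossing (ha : IsTypeSymmetricAveraging δ a)
    (hx : ∀ t i, x (t + 1) i = ∑ j, a t i j * x t j) {S : Finset V} {b : ℝ} {s u : ℕ}
    (hsu : s ≤ u) (hcl : ∀ r, s ≤ r → r < u → ∀ p ∈ S, ∀ q, a r p q ≠ 0 → q ∈ S)
    (hb : ∀ j ∈ S, b ≤ x s j) : ∀ j ∈ S, b ≤ x u j := by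
  induction u, hsu using Nat.le_induction with
  | base => exact hb
  | succ u hu ih =>
    have ih' := ih fun r h1 h2 => hcl r h1 (by omega)
    exact fun j hj => ha.le_succ hx fun q hq => ih' q (hcl u hu (by omega) j hj q hq)

theorem exists_upper_bound (ha : IsTypeSymmetricAveraging δ a)
    (hx : ∀ t i, x (t + 1) i = ∑ j, a t i j * x t j) : ∃ B, ∀ t i, x t i ≤ B := by
  obtain ⟨B, hB⟩ := (Set.finite_range (x 0)).bddAbove
  refine ⟨B, fun t i => ?_⟩
  have hneg : ∀ t i, (-x (t + 1) i) = ∑ j, a t i j * -x t j := by simp [hx]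
  have := ha.le_of_no_crossing (x := fun t i => -x t i) hneg (S := Finset.univ) (b := -B)
    (Nat.zero_le t) (by simp) (fun j _ => neg_le_neg (hB ⟨j, rfl⟩)) i (Finset.mem_univ i)
  exact neg_le_neg_iff.1 this

/-! ### Contraction on a persistently connected component -/

/-- If `C` has no interaction with its complement from time `T` on, and every proper nonempty part
of `C` interacts with the rest of `C` infinitely often, then a single high value in `C` eventually
raises all of `C`. -/
theorem exists_lower_bound (ha : IsTypeSymmetricAveraging δ a)
    (hx : ∀ t i, x (t + 1) i = ∑ j, a t i j * x t j) {C : Finset V} {T : ℕ}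
    (hcl : ∀ r, T ≤ r → ∀ p ∈ C, ∀ q, a r p q ≠ 0 → q ∈ C)
    (hconn : ∀ S ⊆ C, S.Nonempty → S ≠ C → ∃ p ∈ S, ∃ q ∉ S, ∃ᶠ r in atTop, a r p q ≠ 0)
    {t : ℕ} (ht : T ≤ t) {i : V} (hi : i ∈ C) {b : ℝ} (hb : ∀ j ∈ C, b ≤ x t j) :
    ∃ s, t ≤ s ∧ ∀ j ∈ C, b + δ ^ C.card * (x t i - b) ≤ x s j := by
  classical
  have hbs : ∀ s, t ≤ s → ∀ j ∈ C, b ≤ x s j := fun s hs =>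
    ha.le_of_no_crossing hx hs (fun r h _ => hcl r (ht.trans h)) hb
  have hxi : 0 ≤ x t i - b := sub_nonneg.2 (hb i hi)
  have key : ∀ k : ℕ, ∃ s, t ≤ s ∧ ∃ S ⊆ C, S.Nonempty ∧ (k + 1 ≤ S.card ∨ S = C) ∧
      ∀ j ∈ S, b + δ ^ k * (x t i - b) ≤ x s j := by
    intro k
    induction k with
    | zero => exact ⟨t, le_rfl, {i}, by simpa using hi, by simp, by simp, by simp⟩
    | succ k ih =>
      obtain ⟨s, hs, S, hSC, hS, hcard, hlow⟩ := ih
      have hε : 0 ≤ δ ^ k * (x t i - b) := mul_nonneg (pow_nonneg ha.pos.le k) hxi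
      by_cases hne : S = C
      · -- Once `S = C`, one more step preserves the shape and costs at most the factor `δ`.
        subst hne
        refine ⟨s + 1, by omega, S, hSC, hS, Or.inr rfl, fun j hj => ?_⟩
        rw [pow_succ', mul_assoc]
        exact ha.add_mul_le_succ hx
          (fun q hq => hbs s hs q (hcl s (ht.trans hs) j hj q hq)) hε
          (ha.diag_ne_zero s j) (hlow j hj)
      · obtain ⟨p, hp, q, hq, hfreq⟩ := hconn S hSC hS hne
        have hex : ∃ r, s ≤ r ∧ ∃ p ∈ S, ∃ q ∉ S, a r p q ≠ 0 := by
          obtain ⟨r, hr, hr'⟩ := (frequently_atTop.1 hfreq) s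
          exact ⟨r, hr, p, hp, q, hq, hr'⟩
        -- `u` is the first time from `s` on at which `S` interacts with its complement.
        obtain ⟨u, ⟨hsu, p', hp', q', hq', hpq⟩, hmin⟩ :
            ∃ u, (s ≤ u ∧ ∃ p ∈ S, ∃ q ∉ S, a u p q ≠ 0) ∧
              ∀ r < u, ¬(s ≤ r ∧ ∃ p ∈ S, ∃ q ∉ S, a r p q ≠ 0) :=
          ⟨Nat.find hex, Nat.find_spec hex, fun r hr => Nat.find_min hex hr⟩
        have hlow' : ∀ j ∈ S, b + δ ^ k * (x t i - b) ≤ x u j := by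
          refine ha.le_of_no_crossing hx hsu (fun r h1 h2 p hp q hpq => ?_) hlow
          by_contra hqS
          exact hmin r h2 ⟨h1, p, hp, q, hqS, hpq⟩
        have htu : t ≤ u := hs.trans hsu
        set S' := C.filter fun j => ∃ p ∈ S, a u j p ≠ 0 with hS'
        have hSS' : S ⊆ S' := fun j hj =>
          Finset.mem_filter.2 ⟨hSC hj, j, hj, ha.diag_ne_zero u j⟩
        have hq'S' : q' ∈ S' := Finset.mem_filter.2
          ⟨hcl u (ht.trans htu) p' (hSC hp') q' hpq, p', hp', ha.symm u p' q' hpq⟩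
        have hlt : S.card < S'.card :=
          Finset.card_lt_card ((Finset.ssubset_iff_of_subset hSS').2 ⟨q', hq'S', hq'⟩)
        refine ⟨u + 1, by omega, S', Finset.filter_subset _ _, hS.mono hSS', Or.inl ?_, ?_⟩
        · rcases hcard with h | h
          · omega
          · exact absurd h hne
        · intro j hj
          obtain ⟨hjC, p, hp, hjp⟩ := Finset.mem_filter.1 hj
          rw [pow_succ', mul_assoc]
          exact ha.add_mul_le_succ hx
            (fun q hq => hbs u htu q (hcl u (ht.trans htu) j hjC q hq)) hε hjp (hlow' p hp)
  obtain ⟨s, hs, S, hSC, -, hcard, hlow⟩ := key C.card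
  have hSeq : S = C := by
    rcases hcard with h | h
    · have := Finset.card_le_card hSC
      omega
    · exact h
  exact ⟨s, hs, hSeq ▸ hlow⟩

/-- Under the hypotheses of `exists_lower_bound`, the values on `C` reach a consensus. -/
theorem tendsto_of_connected (ha : IsTypeSymmetricAveraging δ a)
    (hx : ∀ t i, x (t + 1) i = ∑ j, a t i j * x t j) {C : Finset V} {T : ℕ}
    (hcl : ∀ r, T ≤ r → ∀ p ∈ C, ∀ q, a r p q ≠ 0 → q ∈ C)
    (hconn : ∀ S ⊆ C, S.Nonempty → S ≠ C → ∃ p ∈ S, ∃ q ∉ S, ∃ᶠ r in atTop, a r p q ≠ 0)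
    (hC : C.Nonempty) : ∃ L, ∀ i ∈ C, Tendsto (fun t => x t i) atTop (𝓝 L) := by
  obtain ⟨B, hB⟩ := ha.exists_upper_bound hx
  -- The minimum over `C`, with time starting at `T`.
  let m : ℕ → ℝ := fun t => C.inf' hC (x (t + T))
  have hm_le : ∀ t, ∀ j ∈ C, m t ≤ x (t + T) j := fun t j hj => Finset.inf'_le _ hj
  have hmono : Monotone m := by
    intro s t hst
    exact Finset.le_inf' _ _ (ha.le_of_no_crossing hx (by omega : s + T ≤ t + T)
      (fun r h _ => hcl r (by omega)) (hm_le s))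
  have hbdd : BddAbove (Set.range m) := by
    obtain ⟨j, hj⟩ := hC
    exact ⟨B, by rintro _ ⟨t, rfl⟩; exact (hm_le t j hj).trans (hB _ _)⟩
  have hlim := tendsto_atTop_ciSup hmono hbdd
  set L := ⨆ t, m t
  have hδ : 0 < δ ^ C.card := pow_pos ha.pos _
  refine ⟨L, fun i hi => (tendsto_add_atTop_iff_nat T).1 ?_⟩
  have hupper : ∀ t, x (t + T) i ≤ m t + (L - m t) / δ ^ C.card := by
    intro t
    obtain ⟨s, hs, hlow⟩ := ha.exists_lower_bound hx hcl hconn (by omega : T ≤ t + T) hi (hm_le t)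
    obtain ⟨r, rfl⟩ : ∃ r, s = r + T := ⟨s - T, by omega⟩
    have h1 : m t + δ ^ C.card * (x (t + T) i - m t) ≤ m r := Finset.le_inf' _ _ hlow
    have h2 : m r ≤ L := le_ciSup hbdd r
    have h3 : x (t + T) i - m t ≤ (L - m t) / δ ^ C.card := by
      rw [le_div_iff₀ hδ]
      linarith
    linarith
  have hlim' : Tendsto (fun t => m t + (L - m t) / δ ^ C.card) atTop (𝓝 L) := by
    simpa using hlim.add ((hlim.const_sub L).div_const (δ ^ C.card))
  exact tendsto_of_tendsto_of_tendsto_of_le_of_le hlim hlim' (fun t => hm_le t i hi) hupper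

/-! ### Convergence of type-symmetric averaging -/

/-- Every orbit of a type-symmetric averaging process converges, whatever the order in which the
interactions occur. -/
theorem tendsto (ha : IsTypeSymmetricAveraging δ a)
    (hx : ∀ t i, x (t + 1) i = ∑ j, a t i j * x t j) (i : V) :
    ∃ L, Tendsto (fun t => x t i) atTop (𝓝 L) := by
  classical
  let R : V → V → Prop := fun p q => ∃ᶠ r in atTop, a r p q ≠ 0
  have hRsymm : Std.Symm R := ⟨fun p q h => h.mono fun r => ha.symm r p q⟩
  have hev : ∀ᶠ r in atTop, ∀ p q, a r p q ≠ 0 → R p q := by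
    refine eventually_all.2 fun p => eventually_all.2 fun q => ?_
    by_cases h : R p q
    · exact Eventually.of_forall fun _ _ => h
    · exact (not_frequently.1 h).mono fun _ h1 h2 => absurd h2 h1
  obtain ⟨T, hT⟩ := eventually_atTop.1 hev
  let C : Finset V := Finset.univ.filter (Relation.ReflTransGen R i)
  have hmem : ∀ {j}, j ∈ C ↔ Relation.ReflTransGen R i j := by simp [C]
  have hiC : i ∈ C := hmem.2 .refl
  have hcl : ∀ r, T ≤ r → ∀ p ∈ C, ∀ q, a r p q ≠ 0 → q ∈ C := fun r hr p hp q hpq =>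
    hmem.2 ((hmem.1 hp).tail (hT r hr p q hpq))
  have hconn : ∀ S ⊆ C, S.Nonempty → S ≠ C →
      ∃ p ∈ S, ∃ q ∉ S, ∃ᶠ r in atTop, a r p q ≠ 0 := by
    intro S hSC ⟨p, hp⟩ hne
    by_contra! hno
    refine hne (hSC.antisymm fun q hq => ?_)
    have hpq : Relation.ReflTransGen R p q :=
      (Relation.ReflTransGen.stdSymm.symm _ _ (hmem.1 (hSC hp))).trans (hmem.1 hq)
    induction hpq with
    | refl => exact hp
    | @tail y z hy hyz ih =>
      have hyS := ih (hmem.2 ((hmem.1 (hSC hp)).trans hy))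
      by_contra hz
      exact hyz (by simpa using hno y hyS z hz)
  obtain ⟨L, hL⟩ := ha.tendsto_of_connected hx hcl hconn ⟨i, hiC⟩
  exact ⟨L, hL i hiC⟩

end IsTypeSymmetricAveraging

/-! ### The Hegselmann–Krause update as an averaging process -/

section Update

variable {V : Type*} [Fintype V] {K : ℕ} {G : SimpleGraph V} {c μ ω : ℝ}
  {X : OpinionState V K} {i j : V} {k : Fin K}

theorem discordance_comm (x y : Fin K → ℝ) : discordance ω k x y = discordance ω k y x := by
  simp only [discordance, abs_sub_comm]

theorem self_mem_receptiveSet : i ∈ receptiveSet G c ω X i k := by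
  simp [receptiveSet]

theorem mem_receptiveSet_symm (h : j ∈ receptiveSet G c ω X i k) :
    i ∈ receptiveSet G c ω X j k := by
  simp only [receptiveSet, Finset.mem_union, Finset.mem_singleton, Finset.mem_filter,
    Finset.mem_univ, true_and] at h ⊢
  exact h.imp Eq.symm fun h => ⟨h.1.symm, discordance_comm (ω := ω) (k := k) _ _ ▸ h.2⟩

open Classical in
/-- The weight that node `i` gives to node `j` in the update of topic `k` from the state `X`. -/
noncomputable def updateWeight (G : SimpleGraph V) (c μ ω : ℝ) (X : OpinionState V K) (k : Fin K) (i j : V) :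
    ℝ :=
  (if j = i then 1 - μ else 0)
    + if j ∈ receptiveSet G c ω X i k then μ / ((receptiveSet G c ω X i k).card : ℝ) else 0

theorem update_eq_sum : update G c μ ω X i k = ∑ j, updateWeight G c μ ω X k i j * X j k := by
  classical
  simp [update, updateWeight, add_mul, Finset.sum_add_distrib, ite_mul, Finset.mul_sum]

theorem sum_updateWeight : ∑ j, updateWeight G c μ ω X k i j = 1 := by
  classical
  have hcard : ((receptiveSet G c ω X i k).card : ℝ) ≠ 0 :=
    Nat.cast_ne_zero.2 (Finset.card_ne_zero_of_mem self_mem_receptiveSet)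
  simp [updateWeight, Finset.sum_add_distrib, mul_div_cancel₀ _ hcard]

theorem updateWeight_of_notMem (h : j ∉ receptiveSet G c ω X i k) :
    updateWeight G c μ ω X k i j = 0 := by
  have hji : j ≠ i := fun e => h (e ▸ self_mem_receptiveSet)
  simp [updateWeight, h, hji]

theorem le_updateWeight_of_mem (hμ_pos : 0 < μ) (hμ_le : μ ≤ 1)
    (h : j ∈ receptiveSet G c ω X i k) :
    μ / (Fintype.card V : ℝ) ≤ updateWeight G c μ ω X k i j := by
  have hcard : (0 : ℝ) < (receptiveSet G c ω X i k).card :=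
    Nat.cast_pos.2 (Finset.card_pos.2 ⟨j, h⟩)
  have h1 : μ / (Fintype.card V : ℝ) ≤ μ / ((receptiveSet G c ω X i k).card : ℝ) :=
    div_le_div_of_nonneg_left hμ_pos.le hcard (Nat.cast_le.2 (Finset.card_le_univ _))
  classical
  have h2 : (0 : ℝ) ≤ if j = i then 1 - μ else 0 := by
    split_ifs <;> linarith
  rw [updateWeight, if_pos h]
  linarith

theorem isTypeSymmetricAveraging_updateWeight [Nonempty V] (hμ_pos : 0 < μ) (hμ_le : μ ≤ 1)
    (Y : ℕ → OpinionState V K) (k : Fin K) :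
    IsTypeSymmetricAveraging (μ / (Fintype.card V : ℝ))
      (fun t => updateWeight G c μ ω (Y t) k) := by
  have hδ : 0 < μ / (Fintype.card V : ℝ) := div_pos hμ_pos (Nat.cast_pos.2 Fintype.card_pos)
  have hle : ∀ t i j, j ∈ receptiveSet G c ω (Y t) i k →
      μ / (Fintype.card V : ℝ) ≤ updateWeight G c μ ω (Y t) k i j :=
    fun _ _ _ => le_updateWeight_of_mem hμ_pos hμ_le
  have hmem : ∀ t i j, updateWeight G c μ ω (Y t) k i j ≠ 0 →
      j ∈ receptiveSet G c ω (Y t) i k :=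
    fun _ _ _ h => not_imp_comm.1 updateWeight_of_notMem h
  refine ⟨hδ, fun t i j => ?_, fun _ _ => sum_updateWeight, fun t i => ?_,
    fun t i j h => hle t i j (hmem t i j h), fun t i j h => ?_⟩
  · by_cases h : j ∈ receptiveSet G c ω (Y t) i k
    · exact hδ.le.trans (hle t i j h)
    · exact (updateWeight_of_notMem h).ge
  · exact (hδ.trans_le (hle t i i self_mem_receptiveSet)).ne'
  · exact (hδ.trans_le (hle t j i (mem_receptiveSet_symm (hmem t i j h)))).ne'

end Update

end TopicHK

theorem theorem3p2 {V : Type*} [Fintype V] (K : ℕ) (G : SimpleGraph V) (c μ ω : ℝ)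
    (hc : 0 ≤ c) (hμ_pos : 0 < μ) (hμ_le : μ ≤ 1) (hω_nonneg : 0 ≤ ω) (hω_le : ω ≤ 1)
    (X₀ : TopicHK.OpinionState V K) :
    ∃ Xlim : TopicHK.OpinionState V K,
      Tendsto (fun t : ℕ => TopicHK.opinionState G c μ ω X₀ t) atTop (𝓝 Xlim) := by
  have hlim : ∀ (i : V) (k : Fin K),
      ∃ L, Tendsto (fun t => TopicHK.opinionState G c μ ω X₀ t i k) atTop (𝓝 L) := by
    intro i k
    have : Nonempty V := ⟨i⟩
    exact (TopicHK.isTypeSymmetricAveraging_updateWeight (G := G) (c := c) (ω := ω) hμ_pos hμ_le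
      (TopicHK.opinionState G c μ ω X₀) k).tendsto
      (x := fun t i => TopicHK.opinionState G c μ ω X₀ t i k)
      (fun _ _ => TopicHK.update_eq_sum) i
  choose L hL using hlim
  exact ⟨L, tendsto_pi_nhds.2 fun i => tendsto_pi_nhds.2 fun k => hL i k⟩
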